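/- Let $\lambda,\alpha$ be real numbers with $|\lambda|<\pi/2$ and $0\le\alpha<1$, and let $a,b\in\mathbb{C}$ with $a+b\ne-1,-2,-3,\dots$. Put $$L=\Re\big[e^{-i\lambda}ab\,(2-\alpha+(1-\alpha)e^{-2i\lambda})\big],$$ $$M=\Im\big[e^{-i\lambda}ab\,(\bar a+\bar b-(1-\alpha)(1+e^{-2i\lambda}))\big],$$ $$N=\Re\big[e^{-i\lambda}ab\,(2\bar a+2\bar b+\alpha-(1-\alpha)e^{-2i\lambda})\big]-\frac{|a|^2|b|^2}{(1-\alpha)\cos\lambda}.$$ If $\Re[e^{-i\lambda}ab]>0$, $L\ge0$, $N\ge0$ and $LN-M^2\ge0$, then the shifted hypergeometric function $f(z)=z\,{}_2F_1(a,b;a+b+1;z)$ is $\lambda$-spirallike of order $\alpha$. That is, $f$ is analytic on the unit disk $\mathbb{D}=\{|z|<1\}$, $f(0)=0$, $f'(0)=1$, $f(z)\ne0$ for $0<|z|<1$, and $$\Re\left(e^{-i\lambda}\frac{zf'(z)}{f(z)}\right)>\alpha\cos\lambda,\qquad z\in\mathbb{D},$$ where $zf'(z)/f(z)$ takes its limiting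 value $1$ at $z=0$. -/

import Mathlib

/-- The class of analytic functions `f` on the open unit disk with `f 0 = 0` and `f' 0 = 1`. -/
def IsNormalizedAnalytic (f : ℂ → ℂ) : Prop :=
  AnalyticOnNhd ℂ f (Metric.ball 0 1) ∧ f 0 = 0 ∧ deriv f 0 = 1

/-- `f` is `l`-spirallike of order `α`: `f` is a normalized analytic function on the unit disk and
`Re (e^{-i l} z f'(z) / f(z)) > α cos l` on the disk. The quotient is required to make sense, i.e.
`f z ≠ 0` for `z ≠ 0`; at `z = 0` it has the removable value `1`, for which the inequality reads
`cos l > α cos l` and holds as soon as `|l| < π / 2` and `α < 1`. -/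
def IsSpirallikeOfOrder (l α : ℝ) (f : ℂ → ℂ) : Prop :=
  IsNormalizedAnalytic f ∧
    ∀ z : ℂ, ‖z‖ < 1 → z ≠ 0 →
      f z ≠ 0 ∧
        α * Real.cos l < (Complex.exp (-(Complex.I * (l : ℂ))) * (z * deriv f z / f z)).re

/-- The shifted hypergeometric function `z ↦ z ₂F₁(a, b; c; z)`. -/
noncomputable def shiftedHypergeometric (a b c : ℂ) (z : ℂ) : ℂ :=
  z * ordinaryHypergeometric a b c z

/-- `L = Re [e^{-i l} a b (2 - α + (1 - α) e^{-2 i l})]`. -/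
noncomputable def spiralL (l α : ℝ) (a b : ℂ) : ℝ :=
  (Complex.exp (-(Complex.I * (l : ℂ))) * a * b *
    (2 - (α : ℂ) + (1 - (α : ℂ)) * Complex.exp (-(2 * Complex.I * (l : ℂ))))).re

/-- `M = Im [e^{-i l} a b (conj a + conj b - (1 - α) (1 + e^{-2 i l}))]`. -/
noncomputable def spiralM (l α : ℝ) (a b : ℂ) : ℝ :=
  (Complex.exp (-(Complex.I * (l : ℂ))) * a * b *
    ((starRingEnd ℂ) a + (starRingEnd ℂ) b
      - (1 - (α : ℂ)) * (1 + Complex.exp (-(2 * Complex.I * (l : ℂ)))))).im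

/-- `N = Re [e^{-i l} a b (2 conj a + 2 conj b + α - (1 - α) e^{-2 i l})]
- |a|² |b|² / ((1 - α) cos l)`. -/
noncomputable def spiralN (l α : ℝ) (a b : ℂ) : ℝ :=
  (Complex.exp (-(Complex.I * (l : ℂ))) * a * b *
    (2 * (starRingEnd ℂ) a + 2 * (starRingEnd ℂ) b + (α : ℂ)
      - (1 - (α : ℂ)) * Complex.exp (-(2 * Complex.I * (l : ℂ))))).re
    - ‖a‖ ^ 2 * ‖b‖ ^ 2 / ((1 - α) * Real.cos l)

/-! Write `F` for ₂F₁(a, b; a+b+1; ·), `k = (1 - α) cos l`, `κ = k e^{il}` and `p = 1 + zF'/(κF)`.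
Since e^{-il} z f'/f = e^{-il} - k + k p and cos l - k = α cos l, the claim is Re p > 0. Suppose
this fails. At a first failure `z`, p(z) = is, and the boundary Schwarz lemma makes t = z p'(z) real
with t ≤ -(1 + s²)/2 (`boundary_deriv_of_re_pos`, `re_one_add_logDeriv_pos`). As c - 1 = a + b, the
hypergeometric equation becomes a Riccati equation for w = zF'/F = κ(p - 1): z w' + w² + (a + b) w =
ab z/(1 - z). Conjugate it, multiply by `ab` and take real parts. The right side exceeds -|ab|²/2,
because Re z/(1 - z) > -1/2 on the disk. The left side is at most -|ab|²/2, because the conditions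
on L, M, N make L s² - 2M s + N nonnegative (`spirallike_admissible`). -/

/-! ### Boundary Schwarz lemma for positive real part -/

open Filter Topology in
/-- A real function that is nonnegative just to the right of one of its zeros has nonnegative
derivative there. -/
theorem HasDerivAt.nonneg_of_eventually_nonneg_right {f : ℝ → ℝ} {d x : ℝ}
    (h : HasDerivAt f d x) (hx : f x = 0) (hf : ∀ᶠ t in 𝓝[>] (0 : ℝ), 0 ≤ f (x + t)) : 0 ≤ d := by
  refine ge_of_tendsto h.tendsto_slope_zero_right ?_
  filter_upwards [hf, self_mem_nhdsWithin] with t ht ht0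
  rw [hx, sub_zero, smul_eq_mul]
  exact mul_nonneg (inv_nonneg.2 (le_of_lt ht0)) ht

/-- If the derivative of `p` at `z` is `d`, this is the derivative of `p` along a ray at `z`. -/
theorem HasDerivAt.comp_ray {p : ℂ → ℂ} {d z : ℂ} (h : HasDerivAt p d z) (η : ℂ) :
    HasDerivAt (fun t : ℝ => p (z + t * η)) (η * d) 0 := by
  have h1 : HasDerivAt (fun t : ℂ => z + t * η) η 0 := by
    simpa using ((hasDerivAt_id (0 : ℂ)).mul_const η).const_add z
  have h2 : HasDerivAt (fun t : ℂ => p (z + t * η)) (d * η) ((0 : ℝ) : ℂ) := by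
    have := HasDerivAt.comp (h₂ := p) (h₂' := d) (0 : ℂ) (by simpa using h) h1
    simpa [Function.comp_def] using this
  rw [mul_comm]
  exact h2.comp_ofReal

/-- Points of the open disk of radius `‖z‖` seen from `z`. -/
theorem norm_add_smul_lt_of_inward {z η : ℂ} (hz : z ≠ 0) (hη : η.re < 0) :
    ∀ᶠ t : ℝ in nhdsWithin 0 (Set.Ioi 0), ‖z + t * (z * η)‖ < ‖z‖ := by
  have hη' : 0 < Complex.normSq η := Complex.normSq_pos.2 (by rintro rfl; simp at hη)
  have hpos : 0 < -2 * η.re / Complex.normSq η := by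
    apply div_pos _ hη'; linarith
  filter_upwards [Ioo_mem_nhdsGT hpos] with t ht
  have h1 : ‖1 + t * η‖ < 1 := by
    have : ‖1 + t * η‖ ^ 2 < 1 := by
      rw [← Complex.normSq_eq_norm_sq, Complex.normSq_apply]
      have h2 := (lt_div_iff₀ hη').1 ht.2
      rw [Complex.normSq_apply] at h2
      simp
      nlinarith [ht.1, mul_lt_mul_of_pos_left h2 ht.1]
    nlinarith [norm_nonneg (1 + t * η)]
  have h3 : z + t * (z * η) = z * (1 + t * η) := by ring
  rw [h3, norm_mul]
  have := norm_pos_iff.2 hz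
  nlinarith

/-- For `p` with positive real part in the disk and `p 0 = 1`, the Schwarz lemma applied to the
Cayley transform of `p`. -/
theorem schwarz_cayley {p : ℂ → ℂ} {r : ℝ} (hp : DifferentiableOn ℂ p (Metric.ball 0 r))
    (h0 : p 0 = 1) (hpos : ∀ z, ‖z‖ < r → 0 < (p z).re) {z : ℂ} (hz : ‖z‖ < r) :
    (r ^ 2 - ‖z‖ ^ 2) * ‖1 + p z‖ ^ 2 ≤ 4 * r ^ 2 * (p z).re := by
  have hr : 0 < r := (norm_nonneg z).trans_lt hz
  have hne : ∀ w, ‖w‖ < r → 1 + p w ≠ 0 := by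
    intro w hw h
    have := congrArg Complex.re h
    have h2 := hpos w hw
    simp at this
    linarith
  have hid : ∀ w : ℂ, ‖1 - w‖ ^ 2 = ‖1 + w‖ ^ 2 - 4 * w.re := by
    intro w
    rw [← Complex.normSq_eq_norm_sq, ← Complex.normSq_eq_norm_sq, Complex.normSq_apply,
      Complex.normSq_apply]
    simp
    ring
  have hd : DifferentiableOn ℂ (fun w => (1 - p w) / (1 + p w)) (Metric.ball 0 r) :=
    DifferentiableOn.div (hp.const_sub 1) (hp.const_add 1)
      (fun w hw => hne w (by simpa using hw))
  have hmaps : Set.MapsTo (fun w => (1 - p w) / (1 + p w)) (Metric.ball 0 r)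
      (Metric.closedBall ((1 - p 0) / (1 + p 0)) 1) := by
    intro w hw
    have hw' : ‖w‖ < r := by simpa using hw
    have h1 := norm_pos_iff.2 (hne w hw')
    simp only [h0, sub_self, zero_div, mem_closedBall_zero_iff, norm_div]
    rw [div_le_one h1]
    refine (sq_le_sq₀ (norm_nonneg _) h1.le).1 ?_
    rw [hid]
    linarith [hpos w hw']
  have h1 := Complex.dist_le_div_mul_dist_of_mapsTo_ball hd hmaps
    (show z ∈ Metric.ball 0 r by simpa using hz)
  have h2 := norm_pos_iff.2 (hne z hz)
  simp only [h0, sub_self, zero_div, dist_zero_right, norm_div] at h1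
  rw [div_le_iff₀ h2] at h1
  have h3 : r * ‖1 - p z‖ ≤ ‖z‖ * ‖1 + p z‖ := by
    calc r * ‖1 - p z‖ ≤ r * (1 / r * ‖z‖ * ‖1 + p z‖) := by gcongr
      _ = _ := by field_simp
  have h4 : (r * ‖1 - p z‖) ^ 2 ≤ (‖z‖ * ‖1 + p z‖) ^ 2 := by gcongr
  rw [mul_pow, mul_pow, hid] at h4
  nlinarith

/-- The boundary Schwarz lemma for functions with positive real part: at a first point `z` where
the real part of `p` vanishes, `z p'(z)` is real and at most `-(1 + (Im p(z))²) / 2`. -/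
theorem boundary_deriv_of_re_pos {p : ℂ → ℂ} {z d : ℂ} (hz : z ≠ 0)
    (hp : DifferentiableOn ℂ p (Metric.ball 0 ‖z‖)) (h0 : p 0 = 1)
    (hpos : ∀ w, ‖w‖ < ‖z‖ → 0 < (p w).re) (hre : (p z).re = 0) (hd : HasDerivAt p d z) :
    (z * d).im = 0 ∧ (z * d).re ≤ -(1 + (p z).im ^ 2) / 2 := by
  have hray : ∀ η : ℂ, HasDerivAt (fun t : ℝ => p (z + t * (z * η))) (z * η * d) 0 :=
    fun η => hd.comp_ray (z * η)
  have hrayre : ∀ η : ℂ,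
      HasDerivAt (fun t : ℝ => (p (z + t * (z * η))).re) (z * η * d).re 0 := fun η => by
    simpa [Function.comp_def] using
      (Complex.reCLM.hasFDerivAt.comp_hasDerivAt (0 : ℝ) (hray η))
  have hrayim : ∀ η : ℂ,
      HasDerivAt (fun t : ℝ => (p (z + t * (z * η))).im) (z * η * d).im 0 := fun η => by
    simpa [Function.comp_def] using
      (Complex.imCLM.hasFDerivAt.comp_hasDerivAt (0 : ℝ) (hray η))
  have key : ∀ η : ℂ, η.re < 0 → 0 ≤ (z * η * d).re := by
    intro η hη
    refine (hrayre η).nonneg_of_eventually_nonneg_right (by simpa using hre) ?_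
    filter_upwards [norm_add_smul_lt_of_inward hz hη] with t ht
    simpa using (hpos _ ht).le
  have hsides : ∀ σ ε : ℝ, 0 < ε → 0 ≤ -ε * (z * d).re - σ * (z * d).im := by
    intro σ ε hε
    have := key (⟨-ε, σ⟩ : ℂ) (by simpa using hε)
    rw [mul_right_comm, Complex.mul_re] at this
    simp only at this
    linarith
  constructor
  · by_contra him
    -- The tangential component σ is unrestricted; this value makes the right side at most -1.
    have h1 := hsides ((|(z * d).re| + 1) / (z * d).im) 1 one_pos
    rw [div_mul_cancel₀ _ him] at h1
    linarith [neg_abs_le (z * d).re]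
  · have hr : 0 < ‖z‖ := norm_pos_iff.2 hz
    -- This is the `schwarz_cayley` inequality at radius (1 - t)‖z‖, divided by ‖z‖². It is an
    -- equality at t = 0, so its derivative there gives the bound.
    have hD : HasDerivAt (fun t : ℝ => 4 * (p (z + t * (z * (-1)))).re
        - (2 * t - t ^ 2) * ((1 + (p (z + t * (z * (-1)))).re) ^ 2
          + (p (z + t * (z * (-1)))).im ^ 2))
        (4 * (z * (-1) * d).re - 2 * (1 + (p z).im ^ 2)) 0 := by
      have h1 := ((hrayre (-1)).const_mul 4).sub
        ((((hasDerivAt_id (0 : ℝ)).const_mul 2).sub ((hasDerivAt_id (0 : ℝ)).pow 2)).mul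
          ((((hrayre (-1)).const_add 1).pow 2).add ((hrayim (-1)).pow 2)))
      refine (h1.congr_deriv ?_)
      simp [hre]
    have h2 := hD.nonneg_of_eventually_nonneg_right (by simp [hre]) ?_
    · have h3 : z * (-1) * d = -(z * d) := by ring
      rw [h3, Complex.neg_re] at h2
      linarith
    · filter_upwards [norm_add_smul_lt_of_inward hz (show (-1 : ℂ).re < 0 by simp),
        Ioo_mem_nhdsGT (zero_lt_one' ℝ)] with t ht ht1
      have h4 := schwarz_cayley hp h0 hpos ht
      have h5 : ‖z + t * (z * (-1))‖ = (1 - t) * ‖z‖ := by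
        have : z + t * (z * (-1)) = ((1 - t : ℝ) : ℂ) * z := by push_cast; ring
        rw [this, norm_mul, Complex.norm_real, Real.norm_of_nonneg (by linarith [ht1.2])]
      rw [h5, ← Complex.normSq_eq_norm_sq (1 + _), Complex.normSq_apply] at h4
      rw [zero_add]
      refine nonneg_of_mul_nonneg_right (a := ‖z‖ ^ 2) ?_ (by positivity)
      simp only [Complex.add_re, Complex.one_re, Complex.add_im, Complex.one_im, zero_add] at h4
      nlinarith

/-! ### Power series and the hypergeometric equation -/

/-- Termwise application of `z d/dz` to a power series converging on the unit disk. -/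
theorem hasSum_mul_deriv_of_hasSum {u : ℕ → ℂ} {F : ℂ → ℂ}
    (h : ∀ z : ℂ, ‖z‖ < 1 → HasSum (fun n => u n * z ^ n) (F z)) {z : ℂ} (hz : ‖z‖ < 1) :
    HasSum (fun n => n * u n * z ^ n) (z * deriv F z) := by
  have hF : ∀ w ∈ Metric.ball (0 : ℂ) 1, HasSum (fun n => u n * w ^ n) (F w) :=
    fun w hw => h w (by simpa using hw)
  have hzm : z ∈ Metric.ball (0 : ℂ) 1 := by simpa using hz
  have hlu : TendstoLocallyUniformlyOn (fun (s : Finset ℕ) w => ∑ n ∈ s, u n * w ^ n) F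
      Filter.atTop (Metric.ball 0 1) := by
    rw [tendstoLocallyUniformlyOn_iff_forall_isCompact Metric.isOpen_ball]
    intro K hK hKc
    obtain ⟨r, hr0, hr1, hKr⟩ : ∃ r : ℝ, 0 ≤ r ∧ r < 1 ∧ ∀ w ∈ K, ‖w‖ ≤ r := by
      rcases K.eq_empty_or_nonempty with rfl | hne
      · exact ⟨0, le_rfl, one_pos, by simp⟩
      · obtain ⟨x, hx, hmax⟩ := hKc.exists_isMaxOn hne continuous_norm.continuousOn
        exact ⟨‖x‖, norm_nonneg _, by simpa using hK hx, fun w hw => hmax hw⟩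
    have hs : Summable fun n => ‖u n‖ * r ^ n := by
      have := (h r (by simpa [abs_of_nonneg hr0] using hr1)).summable.norm
      simpa [abs_of_nonneg hr0] using this
    have := tendstoUniformlyOn_tsum (f := fun n w => u n * w ^ n) (s := K) hs (fun n w hw => by
      rw [norm_mul, norm_pow]
      gcongr
      exact hKr w hw)
    exact this.congr_right fun w hw => (hF w (hK hw)).tsum_eq
  have hder := hlu.deriv (Filter.Eventually.of_forall fun s => by fun_prop) Metric.isOpen_ball
  have h1 := (hder.tendsto_at hzm).const_mul z
  refine Filter.Tendsto.congr (fun s => ?_) h1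
  simp only [Function.comp_apply]
  rw [deriv_fun_sum (fun i _ => by fun_prop), Finset.mul_sum]
  refine Finset.sum_congr rfl fun n _ => ?_
  rw [deriv_const_mul_field, deriv_pow_field]
  rcases n with _ | n
  · simp
  · simp only [Nat.add_sub_cancel]; ring

/-- The series is a polynomial if `a` or `b` is a nonpositive integer; otherwise its radius is
exactly 1. -/
theorem hasFPowerSeriesOnBall_ordinaryHypergeometric {a b c : ℂ} (hc : ∀ n : ℕ, (n : ℂ) ≠ -c) :
    HasFPowerSeriesOnBall (ordinaryHypergeometric a b c : ℂ → ℂ)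
      (ordinaryHypergeometricSeries ℂ a b c) 0 1 := by
  have hr : 1 ≤ (ordinaryHypergeometricSeries ℂ a b c).radius := by
    by_cases ha : ∃ n : ℕ, (n : ℂ) = -a
    · obtain ⟨n, hn⟩ := ha
      rw [show a = -(n : ℂ) by rw [hn, neg_neg], ordinaryHypergeometric_radius_top_of_neg_nat₁]
      exact le_top
    by_cases hb : ∃ n : ℕ, (n : ℂ) = -b
    · obtain ⟨n, hn⟩ := hb
      rw [show b = -(n : ℂ) by rw [hn, neg_neg], ordinaryHypergeometric_radius_top_of_neg_nat₂]
      exact le_top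
    push Not at ha hb
    rw [ordinaryHypergeometricSeries_radius_eq_one ℂ a b c fun n => ⟨ha n, hb n, hc n⟩]
  exact (FormalMultilinearSeries.hasFPowerSeriesOnBall _ (one_pos.trans_le hr)).mono one_pos hr

theorem hasSum_ordinaryHypergeometric {a b c : ℂ} (hc : ∀ n : ℕ, (n : ℂ) ≠ -c) {z : ℂ}
    (hz : ‖z‖ < 1) :
    HasSum (fun n => ordinaryHypergeometricCoefficient a b c n * z ^ n)
      (ordinaryHypergeometric a b c z) := by
  have := (hasFPowerSeriesOnBall_ordinaryHypergeometric (a := a) (b := b) hc).hasSum (y := z)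
    (by simpa [← Metric.eball_ofReal, ← ENNReal.ofReal_one, Metric.eball_ofReal] using hz)
  simp only [zero_add, ordinaryHypergeometricSeries_apply_eq, smul_eq_mul] at this
  exact this

theorem ordinaryHypergeometricCoefficient_succ {a b c : ℂ} (hc : ∀ n : ℕ, (n : ℂ) ≠ -c) (n : ℕ) :
    ((n : ℂ) + 1) * (c + n) * ordinaryHypergeometricCoefficient a b c (n + 1) =
      (a + n) * (b + n) * ordinaryHypergeometricCoefficient a b c n := by
  have h1 : c + n ≠ 0 := fun h => hc n (by linear_combination h)
  have h2 : (n : ℂ) + 1 ≠ 0 := by exact_mod_cast n.succ_ne_zero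
  simp only [ordinaryHypergeometricCoefficient, ascPochhammer_succ_eval, Nat.factorial_succ,
    mul_inv, Nat.cast_mul, Nat.cast_add, Nat.cast_one]
  field_simp

/-- The hypergeometric differential equation, written with the Euler operator `z d/dz`. -/
theorem ordinaryHypergeometric_ode {a b c : ℂ} (hc : ∀ n : ℕ, (n : ℂ) ≠ -c) {F T : ℂ → ℂ}
    (hF : F = ordinaryHypergeometric a b c) (hT : T = fun z => z * deriv F z) {z : ℂ}
    (hz : ‖z‖ < 1) :
    z * deriv T z + (c - 1) * T z = z * (z * deriv T z + (a + b) * T z + a * b * F z) := by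
  have h0 : ∀ w : ℂ, ‖w‖ < 1 →
      HasSum (fun n => ordinaryHypergeometricCoefficient a b c n * w ^ n) (F w) :=
    fun w hw => hF ▸ hasSum_ordinaryHypergeometric hc hw
  have h1 : ∀ w : ℂ, ‖w‖ < 1 →
      HasSum (fun n => n * ordinaryHypergeometricCoefficient a b c n * w ^ n) (T w) :=
    fun w hw => hT ▸ hasSum_mul_deriv_of_hasSum h0 hw
  have h2 := hasSum_mul_deriv_of_hasSum h1 hz
  have hl := h2.add ((h1 z hz).mul_left (c - 1))
  have hr := ((h2.add ((h1 z hz).mul_left (a + b))).add ((h0 z hz).mul_left (a * b))).mul_left z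
  -- The constant term on the left vanishes; dropping it matches the factor `z` on the right.
  rw [← hasSum_nat_add_iff' 1] at hl
  refine HasSum.unique ?_ hr
  simp only [Finset.sum_range_one, Nat.cast_zero, zero_mul, mul_zero, add_zero, sub_zero] at hl
  refine hl.congr_fun fun n => ?_
  have := ordinaryHypergeometricCoefficient_succ (a := a) (b := b) hc n
  push_cast
  linear_combination (-z ^ (n + 1)) * this

/-! ### First failure of positivity -/

/-- The residue of the logarithmic derivative at a zero. -/
theorem AnalyticAt.exists_tendsto_sub_mul_logDeriv {F : ℂ → ℂ} {z : ℂ} (hF : AnalyticAt ℂ F z)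
    (hz : F z = 0) (hne : ¬ ∀ᶠ w in nhds z, F w = 0) :
    ∃ n : ℕ, 1 ≤ n ∧ Filter.Tendsto (fun w => (w - z) * (deriv F w / F w))
      (nhdsWithin z {z}ᶜ) (nhds n) := by
  obtain ⟨n, g, hg, hg0, hFg⟩ := hF.exists_eventuallyEq_pow_smul_nonzero_iff.2 hne
  refine ⟨n, ?_, ?_⟩
  · rw [Nat.one_le_iff_ne_zero]
    rintro rfl
    apply hg0
    simpa [hz] using hFg.self_of_nhds.symm
  have hlim : Filter.Tendsto (fun w => n + (w - z) * (deriv g w / g w)) (nhds z) (nhds n) := by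
    have : ContinuousAt (fun w => n + (w - z) * (deriv g w / g w)) z := by
      have h1 := hg.continuousAt
      have h2 := hg.deriv.continuousAt
      fun_prop (disch := assumption)
    simpa [ContinuousAt] using this
  refine (hlim.mono_left nhdsWithin_le_nhds).congr' ?_
  filter_upwards [hFg.eventually_nhds.filter_mono nhdsWithin_le_nhds,
    hg.eventually_analyticAt.filter_mono nhdsWithin_le_nhds,
    (hg.continuousAt.eventually_ne hg0).filter_mono nhdsWithin_le_nhds,
    self_mem_nhdsWithin] with w hw hgw hgw0 hwz
  have hwz' : w - z ≠ 0 := sub_ne_zero.2 hwz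
  have hd : deriv F w = n * (w - z) ^ (n - 1) * g w + (w - z) ^ n * deriv g w := by
    rw [Filter.EventuallyEq.deriv_eq hw]
    have h1 : HasDerivAt (fun y => (y - z) ^ n) (n * (w - z) ^ (n - 1)) w := by
      simpa using ((hasDerivAt_id w).sub_const z).fun_pow n
    exact (h1.fun_mul hgw.differentiableAt.hasDerivAt).deriv
  rw [hd, hw.self_of_nhds, smul_eq_mul]
  rcases n with _ | n
  · simp
  · rw [Nat.add_sub_cancel]
    field_simp
    ring

/-- If the real part of `1 + z F'(z) / (κ F(z))` is nonnegative in a disk where `F` has no zeros,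
and `Re κ > 0`, then `F` has no zeros on the bounding circle either. -/
theorem ne_zero_of_re_one_add_logDeriv_nonneg {F : ℂ → ℂ} {κ z : ℂ} (hκ : 0 < κ.re) (hz : z ≠ 0)
    (hF : AnalyticAt ℂ F z) (hne : ∀ w, ‖w‖ < ‖z‖ → F w ≠ 0)
    (hpos : ∀ w, ‖w‖ < ‖z‖ → 0 ≤ (1 + w * deriv F w / (κ * F w)).re) : F z ≠ 0 := by
  intro hz0
  have hray : Filter.Tendsto (fun t : ℝ => z + t * (z * (-1))) (nhdsWithin 0 (Set.Ioi 0))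
      (nhdsWithin z {z}ᶜ) := by
    refine tendsto_nhdsWithin_iff.2 ⟨?_, ?_⟩
    · have : ContinuousAt (fun t : ℝ => z + t * (z * (-1))) 0 := by fun_prop
      simpa [ContinuousAt] using this.mono_left nhdsWithin_le_nhds
    · filter_upwards [self_mem_nhdsWithin] with t ht
      have ht0 : (t : ℂ) ≠ 0 := by exact_mod_cast (ne_of_gt ht)
      simp [ht0, hz]
  have hin := norm_add_smul_lt_of_inward hz (show (-1 : ℂ).re < 0 by simp)
  have hnz : ¬ ∀ᶠ w in nhds z, F w = 0 := by
    intro h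
    have h1 := hray.eventually (h.filter_mono nhdsWithin_le_nhds)
    obtain ⟨t, ht, ht'⟩ := (h1.and hin).exists
    exact hne _ ht' ht
  obtain ⟨n, hn, hlim⟩ := hF.exists_tendsto_sub_mul_logDeriv hz0 hnz
  have hcont : Filter.Tendsto (fun t : ℝ => (t : ℂ)) (nhdsWithin 0 (Set.Ioi 0)) (nhds 0) := by
    have : ContinuousAt (fun t : ℝ => (t : ℂ)) 0 := by fun_prop
    simpa [ContinuousAt] using this.mono_left nhdsWithin_le_nhds
  -- At w = (1 - t)z this is t(1 + wF'/(κF)), which tends to -n/κ, of negative real part.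
  have h1 := (hcont.sub ((hcont.const_sub 1).mul ((hlim.comp hray).div_const κ)))
  have h2 := (Complex.continuous_re.tendsto _).comp h1
  have h3 : 0 ≤ ((0 : ℂ) - (1 - 0) * (n / κ)).re := by
    refine ge_of_tendsto h2 ?_
    filter_upwards [hin, self_mem_nhdsWithin] with t ht ht0
    have h4 := mul_nonneg (le_of_lt ht0) (hpos _ ht)
    have h5 : (t : ℂ) - (1 - t) * ((z + t * (z * (-1)) - z) *
        (deriv F (z + t * (z * (-1))) / F (z + t * (z * (-1)))) / κ) =
        (t : ℂ) * (1 + (z + t * (z * (-1))) * deriv F (z + t * (z * (-1))) /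
          (κ * F (z + t * (z * (-1))))) := by
      have := hne _ ht
      have : κ ≠ 0 := by rintro rfl; simp at hκ
      field_simp
      ring
    simp only [Function.comp_apply]
    rw [h5, Complex.re_ofReal_mul]
    exact h4
  have hn' : (0 : ℝ) < n := by exact_mod_cast hn
  have hnsq : 0 < Complex.normSq κ := Complex.normSq_pos.2 (by rintro rfl; simp at hκ)
  have h6 : ((0 : ℂ) - (1 - 0) * (n / κ)).re = -(n * (κ.re / Complex.normSq κ)) := by
    simp [div_eq_mul_inv]
  rw [h6] at h3
  have := mul_pos hn' (div_pos hκ hnsq)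
  linarith

/-- The maximum principle of Miller and Mocanu for the quantity `1 + z F'(z) / (κ F(z))`: it has
positive real part on the unit disk if no boundary configuration is possible. -/
theorem re_one_add_logDeriv_pos {F : ℂ → ℂ} {κ : ℂ} (hκ : 0 < κ.re)
    (hF : AnalyticOnNhd ℂ F (Metric.ball 0 1)) (hF0 : F 0 = 1)
    (hadm : ∀ (z : ℂ) (s t : ℝ), ‖z‖ < 1 → z ≠ 0 → F z ≠ 0 → t ≤ -(1 + s ^ 2) / 2 →
      1 + z * deriv F z / (κ * F z) = Complex.I * s →
      z * deriv (fun w => 1 + w * deriv F w / (κ * F w)) z = t → False)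
    {z : ℂ} (hz : ‖z‖ < 1) : F z ≠ 0 ∧ 0 < (1 + z * deriv F z / (κ * F z)).re := by
  have hκ0 : κ ≠ 0 := by rintro rfl; simp at hκ
  set p : ℂ → ℂ := fun w => 1 + w * deriv F w / (κ * F w) with hp
  -- `G` is |F|² Re p where F ≠ 0, but stays continuous at zeros of `F` and vanishes there. Its
  -- nonpositive set thus captures both ways to fail, and a point of least norm exists.
  set G : ℂ → ℝ := fun w => ((F w + w * deriv F w / κ) * (starRingEnd ℂ) (F w)).re with hG
  have hGp : ∀ w, F w ≠ 0 → G w = Complex.normSq (F w) * (p w).re := by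
    intro w hw
    rw [← Complex.re_ofReal_mul, ← Complex.mul_conj]
    simp only [hG, hp]
    congr 1
    field_simp
  have hiff : ∀ w, 0 < G w ↔ F w ≠ 0 ∧ 0 < (p w).re := by
    intro w
    by_cases hw : F w = 0
    · simp [hG, hw]
    · rw [hGp w hw]
      simp [hw, Complex.normSq_pos]
  have hGc : ContinuousOn G (Metric.ball 0 1) := by
    have h1 := hF.continuousOn
    have h2 := hF.deriv.continuousOn
    have h3 := Complex.continuous_conj.comp_continuousOn h1
    exact Complex.continuous_re.comp_continuousOn
      ((h1.add ((continuousOn_id.mul h2).div_const κ)).mul h3)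
  refine (hiff z).1 ?_
  by_contra hneg
  have hsub : Metric.closedBall (0 : ℂ) ‖z‖ ⊆ Metric.ball 0 1 := Metric.closedBall_subset_ball hz
  have hcomp : IsCompact (Metric.closedBall (0 : ℂ) ‖z‖ ∩ G ⁻¹' Set.Iic 0) :=
    (isCompact_closedBall 0 ‖z‖).of_isClosed_subset
      ((hGc.mono hsub).preimage_isClosed_of_isClosed Metric.isClosed_closedBall isClosed_Iic)
      Set.inter_subset_left
  obtain ⟨y, ⟨hy, hyG⟩, hmin⟩ := hcomp.exists_isMinOn ⟨z, by simp, not_lt.1 hneg⟩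
    continuous_norm.continuousOn
  have hy1 : ‖y‖ < 1 := by simpa using hsub hy
  have hbefore : ∀ w, ‖w‖ < ‖y‖ → F w ≠ 0 ∧ 0 < (p w).re := by
    intro w hw
    rw [← hiff]
    by_contra h
    have hw' : w ∈ Metric.closedBall (0 : ℂ) ‖z‖ := by
      simp only [mem_closedBall_zero_iff] at hy ⊢
      exact hw.le.trans hy
    exact absurd (hmin ⟨hw', not_lt.1 h⟩) (not_le.2 hw)
  have hy0 : y ≠ 0 := by
    rintro rfl
    have : G 0 ≤ 0 := hyG
    norm_num [hG, hF0] at this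
  have hymem : y ∈ Metric.ball (0 : ℂ) 1 := by simpa using hy1
  have hFy : F y ≠ 0 := ne_zero_of_re_one_add_logDeriv_nonneg hκ hy0 (hF y hymem)
    (fun w hw => (hbefore w hw).1) (fun w hw => (hbefore w hw).2.le)
  have hpd : ∀ w, ‖w‖ < 1 → F w ≠ 0 → DifferentiableAt ℂ p w := by
    intro w hw hw0
    have hwm : w ∈ Metric.ball (0 : ℂ) 1 := by simpa using hw
    exact ((differentiableAt_id.mul (hF.deriv w hwm).differentiableAt).div
      ((hF w hwm).differentiableAt.const_mul κ) (mul_ne_zero hκ0 hw0)).const_add 1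
  have hle : (p y).re ≤ 0 := by
    by_contra h
    exact absurd hyG (not_le.2 ((hiff y).2 ⟨hFy, not_le.1 h⟩))
  have hin := norm_add_smul_lt_of_inward hy0 (show (-1 : ℂ).re < 0 by simp)
  have hge : 0 ≤ (p y).re := by
    have hc : ContinuousAt (fun t : ℝ => (p (y + t * (y * (-1)))).re) 0 :=
      Complex.continuous_re.continuousAt.comp
        ((hpd y hy1 hFy).hasDerivAt.comp_ray (y * (-1))).continuousAt
    have hc2 : Filter.Tendsto (fun t : ℝ => (p (y + t * (y * (-1)))).re)
        (nhdsWithin 0 (Set.Ioi 0)) (nhds (p y).re) := by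
      simpa [ContinuousAt] using hc.mono_left nhdsWithin_le_nhds
    refine ge_of_tendsto hc2 ?_
    filter_upwards [hin] with t ht using (hbefore _ ht).2.le
  obtain ⟨him, hre⟩ := boundary_deriv_of_re_pos hy0 (p := p)
    (fun w hw => by
      have hw' : ‖w‖ < ‖y‖ := by simpa using hw
      exact (hpd w (hw'.trans hy1) (hbefore w hw').1).differentiableWithinAt)
    (by simp [hp]) (fun w hw => (hbefore w hw).2) (le_antisymm hle hge)
    (hpd y hy1 hFy).hasDerivAt
  refine hadm y (p y).im (y * deriv p y).re hy1 hy0 hFy hre ?_ ?_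
  · apply Complex.ext
    · rw [show (Complex.I * ((p y).im : ℂ)).re = 0 by simp]
      exact le_antisymm hle hge
    · simp [hp]
  · apply Complex.ext
    · simp
    · simpa using him

/-! ### Excluding the boundary configuration -/

theorem quadratic_nonneg {L M N : ℝ} (hL : 0 ≤ L) (hN : 0 ≤ N) (h : 0 ≤ L * N - M ^ 2) (s : ℝ) :
    0 ≤ L * s ^ 2 + 2 * M * s + N := by
  rcases hL.eq_or_lt with rfl | hL
  · have : M = 0 := by
      have : M ^ 2 = 0 := le_antisymm (by linarith) (sq_nonneg M)
      exact pow_eq_zero_iff two_ne_zero |>.1 this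
    subst this
    linarith
  · refine nonneg_of_mul_nonneg_right (a := L) ?_ hL
    nlinarith [sq_nonneg (L * s + M)]

/-- As Re X > 0, `t` may be replaced by its upper bound -(1 + s²)/2. What remains is minus half the
sum of `D` and the quadratic with coefficients L, M, N at -s. -/
theorem re_le_of_quadratic_form {X S Q : ℂ} {α D s t : ℝ} (hX : 0 < X.re)
    (hL : 0 ≤ (X * (2 - α + (1 - α) * Q)).re)
    (hN : 0 ≤ (X * (2 * S + α - (1 - α) * Q)).re - D)
    (hLMN : 0 ≤ (X * (2 - α + (1 - α) * Q)).re * ((X * (2 * S + α - (1 - α) * Q)).re - D)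
      - (X * (S - (1 - α) * (1 + Q))).im ^ 2)
    (ht : t ≤ -(1 + s ^ 2) / 2) :
    (X * (t + (1 - α) * (1 + Q) / 2 * (Complex.I * s + 1) ^ 2
      - S * (Complex.I * s + 1))).re ≤ -D / 2 := by
  have h1 := quadratic_nonneg hL hN hLMN (-s)
  have h2 := mul_le_mul_of_nonneg_left ht hX.le
  have h3 : (X * (t + (1 - α) * (1 + Q) / 2 * (Complex.I * s + 1) ^ 2
      - S * (Complex.I * s + 1))).re = X.re * t + (X.re * (1 + s ^ 2)
      - ((X * (2 - α + (1 - α) * Q)).re * (-s) ^ 2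
        + 2 * (X * (S - (1 - α) * (1 + Q))).im * (-s)
        + (X * (2 * S + α - (1 - α) * Q)).re)) / 2 := by
    simp [pow_two]
    ring
  rw [h3]
  linarith

/-- The map z/(1 - z) sends the disk to the half-plane Re > -1/2. -/
theorem neg_half_lt_re_div_one_sub {z : ℂ} (hz : ‖z‖ < 1) : -(1 / 2) < (z / (1 - z)).re := by
  have h1 : (1 : ℂ) - z ≠ 0 := fun h => by
    rw [← sub_eq_zero.1 h] at hz
    simp at hz
  have h2 := Complex.normSq_pos.2 h1
  have h3 : Complex.normSq z < 1 := by
    rw [Complex.normSq_eq_norm_sq]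
    nlinarith [norm_nonneg z]
  rw [Complex.div_re, ← add_div, lt_div_iff₀ h2]
  rw [Complex.normSq_apply] at h3 ⊢
  simp
  nlinarith

theorem cos_mul_exp_neg (l : ℝ) :
    (Real.cos l : ℂ) * Complex.exp (-(Complex.I * l)) =
      (1 + Complex.exp (-(2 * Complex.I * l))) / 2 := by
  rw [Complex.ofReal_cos, Complex.cos, div_mul_eq_mul_div, add_mul, ← Complex.exp_add,
    ← Complex.exp_add]
  congr 3
  · rw [← Complex.exp_zero]; congr 1; ring
  · ring

theorem conj_exp_I_mul (l : ℝ) :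
    (starRingEnd ℂ) (Complex.exp (Complex.I * l)) = Complex.exp (-(Complex.I * l)) := by
  rw [← Complex.exp_conj]
  simp

/-- The value of `1 + z F'(z) / (κ F(z))` cannot first become imaginary for
`F = ₂F₁(a, b; a + b + 1; ·)`: here `w = κ (i s - 1)` is the value of `z F'(z) / F(z)` and the
hypothesis `hric` is the Riccati equation that it satisfies. -/
theorem spirallike_admissible {l α : ℝ} (hcos : 0 < Real.cos l) (hα1 : α < 1) {a b : ℂ}
    (hpos : 0 < (Complex.exp (-(Complex.I * (l : ℂ))) * a * b).re)
    (hL : 0 ≤ spiralL l α a b) (hN : 0 ≤ spiralN l α a b)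
    (hLMN : 0 ≤ spiralL l α a b * spiralN l α a b - spiralM l α a b ^ 2) {κ z : ℂ} {s t : ℝ}
    (hκ : κ = ((1 - α) * Real.cos l : ℝ) * Complex.exp (Complex.I * l)) (hz : ‖z‖ < 1)
    (ht : t ≤ -(1 + s ^ 2) / 2)
    (hric : κ * t + (κ * (Complex.I * s - 1)) ^ 2 + (a + b) * (κ * (Complex.I * s - 1)) =
      a * b * (z / (1 - z))) : False := by
  set k : ℝ := (1 - α) * Real.cos l with hk
  have hk0 : 0 < k := mul_pos (by linarith) hcos
  have hab0 : a * b ≠ 0 := by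
    intro h
    rw [mul_assoc, h] at hpos
    simp at hpos
  have h1 := re_le_of_quadratic_form (D := ‖a‖ ^ 2 * ‖b‖ ^ 2 / k) (s := s) (t := t)
    (S := (starRingEnd ℂ) a + (starRingEnd ℂ) b) hpos hL
    (by simpa only [spiralN, mul_add] using hN)
    (by simpa only [spiralN, spiralL, spiralM, mul_add] using hLMN) ht
  set e : ℂ := Complex.exp (-(Complex.I * (l : ℂ))) with he
  have h2 : (1 - (α : ℂ)) * (1 + Complex.exp (-(2 * Complex.I * l))) / 2 = k * e := by
    rw [mul_div_assoc, ← cos_mul_exp_neg, hk]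
    push_cast
    ring
  have hκc : (starRingEnd ℂ) κ = k * e := by
    rw [hκ, map_mul, conj_exp_I_mul, Complex.conj_ofReal]
  -- The conjugated Riccati equation times `ab`; conjugation turns κ(is - 1) into -k e (is + 1).
  have h3 : (k : ℂ) * (e * a * b * (t + k * e * (Complex.I * s + 1) ^ 2
      - ((starRingEnd ℂ) a + (starRingEnd ℂ) b) * (Complex.I * s + 1))) =
      (Complex.normSq (a * b) : ℂ) * (starRingEnd ℂ) (z / (1 - z)) := by
    have h4 := congrArg (starRingEnd ℂ) hric
    rw [map_mul _ (a * b), map_add, map_add] at h4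
    simp only [map_mul (starRingEnd ℂ) κ, map_mul _ (a + b), map_pow, map_add, hκc,
      map_mul (starRingEnd ℂ) Complex.I, map_sub,
      Complex.conj_ofReal, Complex.conj_I, map_one] at h4
    rw [← Complex.mul_conj]
    linear_combination (a * b) * h4
  have h5 := congrArg Complex.re h3
  rw [Complex.re_ofReal_mul, Complex.re_ofReal_mul, Complex.conj_re] at h5
  rw [h2] at h1
  have h6 := mul_le_mul_of_nonneg_left h1 hk0.le
  -- The strictness that yields the contradiction comes from |z| < 1 and ab ≠ 0.
  have h7 := mul_lt_mul_of_pos_left (neg_half_lt_re_div_one_sub hz) (Complex.normSq_pos.2 hab0)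
  have h8 : k * (-(‖a‖ ^ 2 * ‖b‖ ^ 2 / k) / 2) = Complex.normSq (a * b) * -(1 / 2) := by
    rw [Complex.normSq_mul, Complex.normSq_eq_norm_sq, Complex.normSq_eq_norm_sq]
    field_simp
  linarith

/-! ### The spirallikeness theorem -/

theorem mainTheorem4 (l α : ℝ) (hl : |l| < Real.pi / 2) (hα0 : 0 ≤ α) (hα1 : α < 1)
    (a b : ℂ) (hab : ∀ n : ℕ, a + b ≠ -((n : ℂ) + 1))
    (hpos : 0 < (Complex.exp (-(Complex.I * (l : ℂ))) * a * b).re)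
    (hL : 0 ≤ spiralL l α a b) (hN : 0 ≤ spiralN l α a b)
    (hLMN : 0 ≤ spiralL l α a b * spiralN l α a b - spiralM l α a b ^ 2) :
    IsSpirallikeOfOrder l α (shiftedHypergeometric a b (a + b + 1)) := by
  have hcos : 0 < Real.cos l := Real.cos_pos_of_mem_Ioo (abs_lt.1 hl)
  have hc : ∀ n : ℕ, (n : ℂ) ≠ -(a + b + 1) := fun n h =>
    hab n (by linear_combination h)
  set F : ℂ → ℂ := ordinaryHypergeometric a b (a + b + 1) with hFdef
  have hF : AnalyticOnNhd ℂ F (Metric.ball 0 1) := by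
    have := (hasFPowerSeriesOnBall_ordinaryHypergeometric (a := a) (b := b) hc).analyticOnNhd
    rwa [← ENNReal.ofReal_one, Metric.eball_ofReal] at this
  have hF0 : F 0 = 1 := ordinaryHypergeometric_zero a b (a + b + 1)
  have hfeq : shiftedHypergeometric a b (a + b + 1) = fun z => z * F z := rfl
  have hderiv : ∀ z : ℂ, ‖z‖ < 1 → deriv (fun z => z * F z) z = F z + z * deriv F z := by
    intro z hz
    simpa using ((hasDerivAt_id z).fun_mul
      (hF z (by simpa using hz)).differentiableAt.hasDerivAt).deriv
  set k : ℝ := (1 - α) * Real.cos l with hk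
  have hk0 : 0 < k := mul_pos (by linarith) hcos
  set κ : ℂ := k * Complex.exp (Complex.I * l) with hκ
  have hκre : 0 < κ.re := by
    rw [hκ, Complex.re_ofReal_mul, mul_comm Complex.I, Complex.exp_ofReal_mul_I_re]
    positivity
  have hκ0 : κ ≠ 0 := by intro h; simp [h] at hκre
  have main : ∀ z : ℂ, ‖z‖ < 1 → F z ≠ 0 ∧ 0 < (1 + z * deriv F z / (κ * F z)).re := by
    intro z hz
    refine re_one_add_logDeriv_pos hκre hF hF0 (fun y s t hy hy0 hFy ht hval hder => ?_) hz
    have hym : y ∈ Metric.ball (0 : ℂ) 1 := by simpa using hy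
    have h1y : (1 : ℂ) - y ≠ 0 := fun h => by
      rw [← sub_eq_zero.1 h] at hy
      simp at hy
    refine spirallike_admissible hcos hα1 hpos hL hN hLMN (κ := κ) (z := y) hκ hy ht ?_
    have hode := ordinaryHypergeometric_ode hc hFdef rfl hy
    set T : ℂ → ℂ := fun z => z * deriv F z with hT
    have hTd : HasDerivAt T (deriv T y) y :=
      (differentiableAt_id.mul (hF.deriv y hym).differentiableAt).hasDerivAt
    have hd : HasDerivAt (fun w => 1 + w * deriv F w / (κ * F w))
        ((deriv T y * (κ * F y) - T y * (κ * deriv F y)) / (κ * F y) ^ 2) y :=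
      (hTd.div ((hF y hym).differentiableAt.hasDerivAt.const_mul κ)
        (mul_ne_zero hκ0 hFy)).const_add 1
    rw [hd.deriv] at hder
    have hTy : y * deriv F y = T y := rfl
    have hw : κ * (Complex.I * s - 1) = T y / F y := by
      rw [← hval, hTy]
      field_simp
      ring
    -- By the quotient rule κ z p' = zT'/F - w², so the w² terms cancel and the differential
    -- equation remains.
    rw [hw, ← hder, eq_comm]
    have h2 : T y * (y * deriv F y) = T y ^ 2 := by rw [hTy]; ring
    have h3 : a * b * (y / (1 - y)) = (y * deriv T y + (a + b) * T y) / F y := by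
      field_simp
      linear_combination -hode
    rw [h3]
    field_simp
    linear_combination h2
  refine ⟨⟨?_, ?_, ?_⟩, ?_⟩
  · rw [hfeq]
    exact fun z hz => analyticAt_id.mul (hF z hz)
  · simp [hfeq]
  · rw [hfeq, hderiv 0 (by simp)]
    simp [hF0]
  · intro z hz hz0
    obtain ⟨hFz, hre⟩ := main z hz
    rw [hfeq, hderiv z hz]
    refine ⟨mul_ne_zero hz0 hFz, ?_⟩
    have hexp : Complex.exp (-(Complex.I * l)) * Complex.exp (Complex.I * l) = 1 := by
      rw [← Complex.exp_add]; simp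
    have h1 : Complex.exp (-(Complex.I * l)) * (z * (F z + z * deriv F z) / (z * F z)) =
        Complex.exp (-(Complex.I * l)) - k + k * (1 + z * deriv F z / (κ * F z)) := by
      have hq : z * deriv F z / F z = κ * (z * deriv F z / (κ * F z)) := by field_simp
      have hq2 : z * (F z + z * deriv F z) / (z * F z) = 1 + z * deriv F z / F z := by
        field_simp
      rw [hq2, hq, hκ]
      linear_combination (k * (z * deriv F z / (k * Complex.exp (Complex.I * l) * F z))) * hexp
    have h2 : (Complex.exp (-(Complex.I * l))).re = Real.cos l := by
      rw [← conj_exp_I_mul, Complex.conj_re, mul_comm, Complex.exp_ofReal_mul_I_re]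
    rw [h1, Complex.add_re, Complex.sub_re, Complex.re_ofReal_mul, Complex.ofReal_re, h2]
    have := mul_pos hk0 hre
    have hk' : k = Real.cos l - α * Real.cos l := by rw [hk]; ring
    linarith
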